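/- Let $X$ be an irreducible, aperiodic, discrete-time Markov chain on a finite state space $S$ with at least two elements, with transition matrix $P$ and stationary distribution $\pi$, and let $j\in S$. Let $W_j=\inf\{t\ge 0: X_t=j\}$ be the hitting time of $j$ when $X_0\sim\pi$. Let $\pi^{(j)}=\frac{\pi-\pi_j\delta_j}{1-\pi_j}$ be the stationary distribution restricted to the states other than $j$, and let $T^{(j)}$ be any strong stationary time for the chain with initial distribution $X_0\sim\pi^{(j)}$, that is, an almost surely finite randomized stopping time such that $X_{T^{(j)}}\sim\pi$ and $X_{T^{(j)}}$ is independent of $T^{(j)}$. (A randomized stopping time is a stopping time with respect to some filtration to which $X$ is adapted and with respect to which $X$ is a Markov chain with transition matrix $P$.) Let $U=T^{(j)}_1+\cdots+T^{(j)}_N$, where $T^{(j)}_1,T^{(j)}_2,\ldots$ are IID copies of $T^{(j)}$ and $N$ is independent of them with $\mathbb{P}(N=k)=\pi_j(1-\pi_j)^k$ for $k=0,1,2,\ldots$. Then $$d_{TV}(\mathcal{L}(W_j),\mathcal{L}(U))\le (1-\pi_j)\,\mathbb{E}T^{(j)}-\pi_j\,\mathbb{E}W_j ,$$ where $d_{TV}(\mathcal{L}(W_j),\mathcal{L}(U))=\sup_{A}|\mathbb{P}(W_j\in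 A)-\mathbb{P}(U\in A)|$, the supremum being over all sets $A$ of values. The right-hand side is read in the extended reals; it is $+\infty$ if $\mathbb{E}T^{(j)}=\infty$. -/

import Mathlib

open MeasureTheory ProbabilityTheory
open scoped ENNReal

namespace MarkovHitting

/-- `P` is aperiodic: for every state `x`, the greatest common divisor of the set of
`t ≥ 1` with `Pᵗ(x, x) > 0` is `1`. -/
def IsAperiodic {S : Type*} [Fintype S] [DecidableEq S] (P : Matrix S S ℝ) : Prop :=
  ∀ x : S, ∀ d : ℕ, (∀ t : ℕ, 1 ≤ t → 0 < (P ^ t) x x → d ∣ t) → d = 1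

/-- `P` is the transition matrix of an irreducible, ergodic (that is, aperiodic) Markov chain
on the finite state space `S`. -/
structure IsErgodic {S : Type*} [Fintype S] [DecidableEq S] (P : Matrix S S ℝ) : Prop where
  stochastic : P ∈ Matrix.rowStochastic ℝ S
  irreducible : P.IsIrreducible
  aperiodic : IsAperiodic P

/-- The probability vector `π` is a stationary distribution of `P`. -/
structure IsStationary {S : Type*} [Fintype S] (P : Matrix S S ℝ) (π : S → ℝ) : Prop where
  prob : π ∈ stdSimplex ℝ S
  invariant : Matrix.vecMul π P = π

/-- `π⁽ʲ⁾ = (π - π_j δ_j) / (1 - π_j)`, the distribution `π` restricted to the states other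
than `j`. -/
noncomputable def restrictAway {S : Type*} [DecidableEq S] (π : S → ℝ) (j : S) : S → ℝ :=
  fun x => (π x - π j * (if x = j then 1 else 0)) / (1 - π j)

/-- `X` is a discrete time Markov chain under `μ` with transition matrix `P` and
`X₀ ∼ ν`:  `ℙ(X₀ = x₀) = ν(x₀)` and
`ℙ(X₀ = x₀, …, X_{n+1} = x_{n+1}) = ℙ(X₀ = x₀, …, X_n = x_n) P(x_n, x_{n+1})`. -/
structure IsMarkovChain {S Ω : Type*} [MeasurableSpace S] [MeasurableSpace Ω]
    (P : Matrix S S ℝ) (ν : S → ℝ) (μ : Measure Ω) (X : ℕ → Ω → S) : Prop where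
  measurable : ∀ t, Measurable (X t)
  initial : ∀ x, μ.real {ω | X 0 ω = x} = ν x
  step : ∀ (n : ℕ) (x : ℕ → S),
    μ.real {ω | ∀ i ≤ n + 1, X i ω = x i} =
      μ.real {ω | ∀ i ≤ n, X i ω = x i} * P (x n) (x (n + 1))

/-- `T` is a randomized stopping time for the Markov chain `X`: it is a stopping time for some
filtration `ℱ` (possibly carrying extra randomness) to which `X` is adapted and with respect to
which `X` is still a Markov chain with transition matrix `P`. -/
def IsRandomizedStoppingTime {S Ω : Type*} [MeasurableSpace S] [mΩ : MeasurableSpace Ω]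
    (P : Matrix S S ℝ) (μ : Measure Ω) (X : ℕ → Ω → S) (T : Ω → ℕ∞) : Prop :=
  ∃ ℱ : Filtration ℕ mΩ,
    Adapted ℱ X ∧
    (∀ (t : ℕ) (A : Set Ω), MeasurableSet[ℱ t] A → ∀ x y : S,
      μ.real (A ∩ {ω | X t ω = x ∧ X (t + 1) ω = y}) =
        μ.real (A ∩ {ω | X t ω = x}) * P x y) ∧
    IsStoppingTime ℱ T

/-- `T` is a strong stationary time for the Markov chain `X`, with stationary distribution `π`:
an (almost surely finite) randomized stopping time such that `X_T ∼ π` and `X_T` is independent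
of `T`. -/
structure IsStrongStationaryTime {S Ω : Type*} [Nonempty S] [MeasurableSpace S]
    [MeasurableSpace Ω] (P : Matrix S S ℝ) (π : S → ℝ) (μ : Measure Ω) (X : ℕ → Ω → S)
    (T : Ω → ℕ∞) : Prop where
  stopping : IsRandomizedStoppingTime P μ X T
  finite : ∀ᵐ ω ∂μ, T ω ≠ ⊤
  law : ∀ x, μ.real {ω | stoppedValue X T ω = x} = π x
  indep : IndepFun (stoppedValue X T) T μ

/-- `W_j = inf {t ≥ 0 : X_t = j}`, which is `⊤` if the state `j` is never visited. -/
noncomputable def hittingTime {S Ω : Type*} (X : ℕ → Ω → S) (j : S) : Ω → ℕ∞ :=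
  hittingAfter X {j} 0

/-- `N ∼ Geom(p)`: `ℙ(N = k) = p (1 - p)ᵏ` for `k = 0, 1, 2, …`. -/
structure IsGeometric {Ω : Type*} [MeasurableSpace Ω] (p : ℝ) (μ : Measure Ω) (N : Ω → ℕ) :
    Prop where
  measurable : Measurable N
  law : ∀ k, μ.real {ω | N ω = k} = p * (1 - p) ^ k

/-- `U` is the sum `T₁ + ⋯ + T_N` of IID copies `T₁, T₂, …` (defined under `μ`) of the random
variable `T` (defined under `μ'`), where `N ∼ Geom(p)` is independent of `(T₁, T₂, …)`. -/
def IsGeometricSum {Ω Ω' : Type*} [MeasurableSpace Ω] [MeasurableSpace Ω'] (p : ℝ)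
    (T : Ω' → ℕ∞) (μ' : Measure Ω') (μ : Measure Ω) (U : Ω → ℕ∞) : Prop :=
  ∃ (N : Ω → ℕ) (τ : ℕ → Ω → ℕ∞),
    IsGeometric p μ N ∧
    (∀ i, IdentDistrib (τ i) T μ μ') ∧
    iIndepFun τ μ ∧
    IndepFun N (fun ω i => τ i ω) μ ∧
    ∀ ω, U ω = ∑ i ∈ Finset.range (N ω), τ i ω

/-- The total variation distance `sup_A |μ(A) - ν(A)|` of laws of `ℕ∞`-valued random
variables (all subsets of `ℕ∞` are measurable). -/
noncomputable def tvDist (μ ν : Measure ℕ∞) : ℝ :=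
  ⨆ A : Set ℕ∞, |μ.real A - ν.real A|

/-- The expectation, in `[0, ∞]`, of an `ℕ∞`-valued random variable. -/
noncomputable def expect {Ω : Type*} [MeasurableSpace Ω] (μ : Measure Ω) (Y : Ω → ℕ∞) : ℝ≥0∞ :=
  ∫⁻ ω, (Y ω : ℝ≥0∞) ∂μ

end MarkovHitting

/-! Write `p = π j`, `w` for the law of `W_j` started from `π`, `v` for the law of the hitting time
`V` started from `π⁽ʲ⁾`, and `t`, `u` for the laws of `T` and `U`. Peeling one summand off the
geometric sum gives `u = p δ₀ + (1 - p) t ∗ u`, and splitting `π` into its atom at `j` and the rest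
gives `w = p δ₀ + (1 - p) v`.

Let `R` be the time from `T` to the next visit to `j`. Strong stationarity makes `R` independent of
`T` with law `w`, so `T + R` has law `t ∗ w`. On `{T ≤ V}` one has `V = T + R`, hence `v` and `t ∗
w` differ by at most `q = ℙ(V < T)`. Convolution with `t` does not increase total variation, so `d ≤
(1 - p)(q + d)` for the distance `d` of `w` and `u`, that is `p d ≤ (1 - p) q` (`mul_tvDist_le`).

To bound `q`, note that `T + R` is the time of a visit to `j`. It is at least `V`, and on `{V < T}`
it is at least the second visit, which comes a return time after `V`. That return time has mean `1 /
p` by Kac's formula, also given `V < T`, since this event is decided by time `V`. Hence `𝔼V + q / p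
≤ 𝔼T + 𝔼W` (`measure_lt_add_le`). With `𝔼W = (1 - p) 𝔼V` the two bounds combine to the claim. -/

namespace MarkovHitting

/-! ### Avoidance probabilities and their summability. -/

section Avoid

variable {S : Type*} [Fintype S] [DecidableEq S]

/-- The probability that the chain started from `x` satisfies `X_i ≠ j` for all `i < n`. -/
def avoid (P : Matrix S S ℝ) (j : S) : ℕ → S → ℝ
  | 0, _ => 1
  | n + 1, x => if x = j then 0 else ∑ y, P x y * avoid P j n y

variable {P : Matrix S S ℝ} {j : S}

lemma avoid_zero (x : S) : avoid P j 0 x = 1 := rfl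

lemma avoid_succ_self (n : ℕ) : avoid P j (n + 1) j = 0 := by simp [avoid]

lemma avoid_succ_of_ne (n : ℕ) {x : S} (hx : x ≠ j) :
    avoid P j (n + 1) x = ∑ y, P x y * avoid P j n y := by simp [avoid, hx]

lemma row_sum (hP : P ∈ Matrix.rowStochastic ℝ S) (x : S) : ∑ y, P x y = 1 := by
  have h := congrFun hP.2 x
  simpa [Matrix.mulVec, dotProduct] using h

lemma avoid_nonneg (hP : P ∈ Matrix.rowStochastic ℝ S) (n : ℕ) (x : S) :
    0 ≤ avoid P j n x := by
  induction n generalizing x with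
  | zero => simp [avoid]
  | succ n ih =>
    simp only [avoid]
    split_ifs
    · exact le_rfl
    · exact Finset.sum_nonneg fun y _ => mul_nonneg (hP.1 x y) (ih y)

/-- Markov property at time `n`: after `n` steps without `j`, avoiding `j` for `m` more has
probability at most `c` from any state. -/
lemma avoid_add_le (hP : P ∈ Matrix.rowStochastic ℝ S) {m : ℕ} {c : ℝ}
    (hc : ∀ x, avoid P j m x ≤ c) (n : ℕ) (x : S) :
    avoid P j (n + m) x ≤ c * avoid P j n x := by
  induction n generalizing x with
  | zero => simpa [avoid] using hc x
  | succ n ih =>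
    rw [Nat.add_right_comm]
    by_cases hx : x = j
    · simp [avoid, hx]
    · rw [avoid_succ_of_ne _ hx, avoid_succ_of_ne _ hx, Finset.mul_sum]
      refine Finset.sum_le_sum fun y _ => ?_
      calc P x y * avoid P j (n + m) y ≤ P x y * (c * avoid P j n y) :=
            mul_le_mul_of_nonneg_left (ih y) (hP.1 x y)
        _ = c * (P x y * avoid P j n y) := by ring

lemma avoid_le_one (hP : P ∈ Matrix.rowStochastic ℝ S) (n : ℕ) (x : S) :
    avoid P j n x ≤ 1 := by
  induction n generalizing x with
  | zero => simp [avoid]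
  | succ n ih =>
    by_cases hx : x = j
    · simp [avoid, hx]
    · rw [avoid_succ_of_ne _ hx, ← row_sum hP x]
      exact Finset.sum_le_sum fun y _ => mul_le_of_le_one_right (hP.1 x y) (ih y)

lemma avoid_antitone (hP : P ∈ Matrix.rowStochastic ℝ S) (x : S) :
    Antitone fun n => avoid P j n x :=
  antitone_nat_of_succ_le fun n => by
    simpa using avoid_add_le hP (fun x => avoid_le_one (j := j) hP 1 x) n x

/-- A positive-weight path of length `k` ends in `j`. The index is `k + 1` because `avoid P j (k +
1)` covers the times `0, …, k`. -/
lemma avoid_lt_one (hP : P ∈ Matrix.rowStochastic ℝ S) (k : ℕ) (x : S)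
    (hk : 0 < (P ^ k) x j) : avoid P j (k + 1) x < 1 := by
  induction k generalizing x with
  | zero =>
    by_cases hx : x = j
    · simp [avoid, hx]
    · simp [hx] at hk
  | succ k ih =>
    by_cases hx : x = j
    · simp [avoid, hx]
    · rw [pow_succ', Matrix.mul_apply] at hk
      obtain ⟨y, -, hy⟩ : ∃ y ∈ Finset.univ, 0 < P x y * (P ^ k) y j :=
        Finset.exists_lt_of_sum_lt (f := fun _ => (0 : ℝ)) (by simpa using hk)
      have hPxy : 0 < P x y := (hP.1 x y).lt_of_ne fun h => by simp [← h] at hy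
      rw [avoid_succ_of_ne _ hx, ← row_sum hP x]
      refine Finset.sum_lt_sum
        (fun z _ => mul_le_of_le_one_right (hP.1 x z) (avoid_le_one hP _ z))
        ⟨y, Finset.mem_univ y, mul_lt_of_lt_one_right hPxy (ih y ?_)⟩
      exact (pos_iff_pos_of_mul_pos hy).1 hPxy

/-- Irreducibility gives each state its own horizon; finiteness of `S` allows a common horizon and a
worst starting state. -/
lemma exists_avoid_le (hP : P ∈ Matrix.rowStochastic ℝ S) (hirr : P.IsIrreducible) :
    ∃ m : ℕ, ∃ c < 1, ∀ x, avoid P j m x ≤ c := by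
  have : Nonempty S := ⟨j⟩
  choose k _ hk using fun x => (Matrix.isIrreducible_iff_exists_pow_pos hP.1).1 hirr x j
  let m := Finset.univ.sup fun x => k x + 1
  obtain ⟨z, -, hz⟩ := Finset.exists_max_image Finset.univ (avoid P j m) Finset.univ_nonempty
  refine ⟨m, avoid P j m z, ?_, fun x => hz x (Finset.mem_univ x)⟩
  exact (avoid_antitone hP z (Finset.le_sup (f := fun x => k x + 1) (Finset.mem_univ z))).trans_lt
    (avoid_lt_one hP _ _ (hk z))

/-- By submultiplicativity a partial sum `s` satisfies `s ≤ m + c * s`, hence `s ≤ m / (1 - c)`. -/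
lemma summable_avoid (hP : P ∈ Matrix.rowStochastic ℝ S) (hirr : P.IsIrreducible) (x : S) :
    Summable fun n => avoid P j n x := by
  obtain ⟨m, c, hc, hm⟩ := exists_avoid_le (j := j) hP hirr
  refine summable_of_sum_range_le (c := m / (1 - c)) (fun n => avoid_nonneg hP n x) fun N => ?_
  rw [le_div_iff₀ (by linarith)]
  have h1 : ∑ n ∈ Finset.range N, avoid P j n x ≤ ∑ n ∈ Finset.range (m + N), avoid P j n x :=
    Finset.sum_le_sum_of_subset_of_nonneg (Finset.range_mono (by lia))
      fun n _ _ => avoid_nonneg hP n x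
  rw [Finset.sum_range_add] at h1
  have h2 : ∑ n ∈ Finset.range m, avoid P j n x ≤ m := by
    calc _ ≤ ∑ n ∈ Finset.range m, (1 : ℝ) := Finset.sum_le_sum fun n _ => avoid_le_one hP n x
      _ = m := by simp
  have h3 : ∑ n ∈ Finset.range N, avoid P j (m + n) x
      ≤ c * ∑ n ∈ Finset.range N, avoid P j n x := by
    rw [Finset.mul_sum]
    exact Finset.sum_le_sum fun n _ => by simpa [add_comm] using avoid_add_le hP hm n x
  linarith

end Avoid

/-! ### Stationary distributions and Kac's formula. -/

section Stationary

variable {S : Type*} [Fintype S] [DecidableEq S] {P : Matrix S S ℝ} {π : S → ℝ} {j : S}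

lemma IsStationary.pow (hπ : IsStationary P π) (k : ℕ) (y : S) :
    ∑ x, π x * (P ^ k) x y = π y := by
  have h : Matrix.vecMul π (P ^ k) = π := by
    induction k with
    | zero => simp
    | succ k ih => rw [pow_succ, ← Matrix.vecMul_vecMul, ih, hπ.invariant]
  simpa [Matrix.vecMul, dotProduct] using congrFun h y

lemma IsStationary.pos (hπ : IsStationary P π) (hP : P ∈ Matrix.rowStochastic ℝ S)
    (hirr : P.IsIrreducible) (y : S) : 0 < π y := by
  obtain ⟨x, -, hx⟩ : ∃ x ∈ Finset.univ, 0 < π x :=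
    Finset.exists_lt_of_sum_lt (f := 0) (by simp [hπ.prob.2])
  obtain ⟨k, -, hk⟩ := (Matrix.isIrreducible_iff_exists_pow_pos hP.1).1 hirr x y
  rw [← hπ.pow k y]
  refine Finset.sum_pos' (fun z _ => mul_nonneg (hπ.prob.1 z) ?_)
    ⟨x, Finset.mem_univ x, mul_pos hx hk⟩
  exact Matrix.pow_apply_nonneg hP.1 k z y

lemma IsStationary.lt_one [Nontrivial S] (hπ : IsStationary P π)
    (hP : P ∈ Matrix.rowStochastic ℝ S) (hirr : P.IsIrreducible) : π j < 1 := by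
  obtain ⟨i, hi⟩ := exists_ne j
  have h : ∑ x ∈ {i, j}, π x ≤ ∑ x, π x :=
    Finset.sum_le_sum_of_subset_of_nonneg (Finset.subset_univ _) fun x _ _ => hπ.prob.1 x
  rw [Finset.sum_pair hi, hπ.prob.2] at h
  linarith [hπ.pos hP hirr i]

/-- Started from stationarity, `ℙ(W_j = n) = π_j ℙ_j(τ_j > n)`, with `τ_j` the return time. -/
lemma IsStationary.sum_avoid_sub (hπ : IsStationary P π) (n : ℕ) :
    ∑ x, π x * avoid P j n x - ∑ x, π x * avoid P j (n + 1) x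
      = π j * ∑ y, P j y * avoid P j n y := by
  -- Stationarity replaces `π` by `πP`; the two sums then agree term by term except at `x = j`,
  -- where `avoid P j (n + 1)` vanishes.
  have h1 : ∑ x, π x * avoid P j n x = ∑ x, π x * ∑ y, P x y * avoid P j n y := by
    simp_rw [Finset.mul_sum, ← mul_assoc]
    rw [Finset.sum_comm]
    simp_rw [← Finset.sum_mul]
    refine Finset.sum_congr rfl fun y _ => ?_
    have := hπ.pow 1 y
    rw [pow_one] at this
    rw [this]
  rw [h1, ← Finset.sum_sub_distrib, Finset.sum_eq_single j]
  · simp [avoid_succ_self]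
  · intro x _ hx
    rw [avoid_succ_of_ne _ hx, sub_self]
  · simp

/-- Kac's formula: the mean return time to `j` is `1 / π_j`. -/
lemma IsStationary.hasSum_return (hπ : IsStationary P π) (hP : P ∈ Matrix.rowStochastic ℝ S)
    (hirr : P.IsIrreducible) :
    HasSum (fun n => π j * ∑ y, P j y * avoid P j n y) 1 := by
  rw [hasSum_iff_tendsto_nat_of_nonneg]
  · simp_rw [← hπ.sum_avoid_sub, Finset.sum_range_sub']
    have h : Filter.Tendsto (fun n => ∑ x, π x * avoid P j n x) Filter.atTop (nhds 0) := by
      have := tendsto_finsetSum Finset.univ fun x _ =>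
        ((summable_avoid (j := j) hP hirr x).tendsto_atTop_zero).const_mul (π x)
      simpa using this
    simpa [avoid_zero, hπ.prob.2] using h.const_sub 1
  · exact fun n => mul_nonneg (hπ.prob.1 j)
      (Finset.sum_nonneg fun y _ => mul_nonneg (hP.1 j y) (avoid_nonneg hP n y))

end Stationary

/-! ### Residual hitting times and the Markov property. -/

section Chain

variable {S Ω : Type*}

/-- The time from `s` until the next visit of `X` to `j`. -/
noncomputable def residual (X : ℕ → Ω → S) (j : S) (s : ℕ) : Ω → ℕ∞ :=
  hittingTime (fun i => X (s + i)) j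

lemma residual_zero (X : ℕ → Ω → S) (j : S) : residual X j 0 = hittingTime X j := by
  simp [residual]

lemma le_residual_iff {X : ℕ → Ω → S} {j : S} {s n : ℕ} {ω : Ω} :
    (n : ℕ∞) ≤ residual X j s ω ↔ ∀ i < n, X (s + i) ω ≠ j := by
  have h : residual X j s ω < (n : ℕ∞) ↔ _ :=
    hittingAfter_lt_iff (u := fun i => X (s + i)) (s := {j}) (n := 0) (i := n) (ω := ω)
  rw [← not_lt, h]
  simp

/-- `s + residual X j s` is the absolute time of the first visit at or after `s`, which is monotone
in `s`. -/
lemma add_residual_le {X : ℕ → Ω → S} {j : S} {s t : ℕ} (hst : s ≤ t) (ω : Ω) :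
    (s : ℕ∞) + residual X j s ω ≤ t + residual X j t ω := by
  obtain ⟨k, rfl⟩ := Nat.exists_eq_add_of_le hst
  rw [Nat.cast_add, add_assoc]
  gcongr
  refine ENat.forall_natCast_le_iff_le.1 fun n hn => ?_
  rw [le_residual_iff] at hn
  by_cases hk : n ≤ k
  · exact (Nat.cast_le.2 hk).trans le_self_add
  · obtain ⟨m, rfl⟩ := Nat.exists_eq_add_of_le (not_le.1 hk).le
    rw [Nat.cast_add]
    gcongr
    rw [le_residual_iff]
    intro i hi
    rw [add_assoc]
    exact hn _ (by lia)

lemma eq_of_residual_eq {X : ℕ → Ω → S} {j : S} {s : ℕ} {ω : Ω}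
    (h : residual X j 0 ω = s) : X s ω = j := by
  by_contra hne
  have h1 : ((s + 1 : ℕ) : ℕ∞) ≤ residual X j 0 ω := by
    rw [le_residual_iff]
    intro i hi
    rcases Nat.lt_succ_iff_lt_or_eq.1 hi with hi | rfl
    · exact le_residual_iff.1 h.ge i hi
    · simpa using hne
  rw [h] at h1
  exact absurd (Nat.cast_le.1 h1) (by lia)

variable [MeasurableSpace Ω] [MeasurableSpace S]

/-- `X` is Markov with respect to the classes `𝒜 t` of events determined by time `t`. -/
structure IsMarkovFor (P : Matrix S S ℝ) (μ : Measure Ω) (X : ℕ → Ω → S)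
    (𝒜 : ℕ → Set Ω → Prop) : Prop where
  measurable : ∀ t, Measurable (X t)
  inter : ∀ t A x, 𝒜 t A → 𝒜 (t + 1) (A ∩ {ω | X t ω = x})
  step : ∀ t A x y, 𝒜 t A → μ.real (A ∩ {ω | X t ω = x ∧ X (t + 1) ω = y}) =
    μ.real (A ∩ {ω | X t ω = x}) * P x y

/-- The events `{X_0 = x_0, …, X_{t-1} = x_{t-1}}`. -/
def IsCylinder (X : ℕ → Ω → S) (t : ℕ) (A : Set Ω) : Prop :=
  ∃ x : ℕ → S, A = {ω | ∀ i < t, X i ω = x i}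

/-- Lets one tail computation serve both the bare chain, through cylinders, and the filtration that
carries `T`. -/
lemma IsMarkovChain.isMarkovFor {ν : S → ℝ} {P : Matrix S S ℝ} {μ : Measure Ω}
    {X : ℕ → Ω → S} (h : IsMarkovChain P ν μ X) :
    IsMarkovFor P μ X (IsCylinder X) where
  measurable := h.measurable
  inter := by
    rintro t _ x ⟨z, rfl⟩
    refine ⟨Function.update z t x, ?_⟩
    ext ω
    simp only [Set.mem_inter_iff, Set.mem_ofPred_eq, Nat.lt_succ_iff_lt_or_eq]
    constructor
    · rintro ⟨h1, h2⟩ i (hi | rfl)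
      · rw [Function.update_of_ne hi.ne, h1 i hi]
      · simpa using h2
    · intro h1
      refine ⟨fun i hi => ?_, by simpa using h1 t (.inr rfl)⟩
      simpa [hi.ne] using h1 i (.inl hi)
  step := by
    rintro t _ x y ⟨z, rfl⟩
    let z' := Function.update (Function.update z t x) (t + 1) y
    have hz {i : ℕ} (hi : i < t) : z' i = z i := by
      simp [z', Function.update_of_ne hi.ne, Function.update_of_ne (hi.trans (Nat.lt_succ_self t)).ne]
    have hzt : z' t = x := by simp [z']
    have hzt' : z' (t + 1) = y := by simp [z']
    have h1 : {ω | ∀ i < t, X i ω = z i} ∩ {ω | X t ω = x} = {ω | ∀ i ≤ t, X i ω = z' i} := by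
      ext ω
      simp only [Set.mem_inter_iff, Set.mem_ofPred_eq, le_iff_lt_or_eq]
      constructor
      · rintro ⟨h1, h2⟩ i (hi | rfl)
        · rw [hz hi, h1 i hi]
        · rw [hzt, h2]
      · intro h1
        exact ⟨fun i hi => by rw [← hz hi, h1 i (.inl hi)], by rw [← hzt, h1 t (.inr rfl)]⟩
    have h2 : {ω | ∀ i < t, X i ω = z i} ∩ {ω | X t ω = x ∧ X (t + 1) ω = y} =
        {ω | ∀ i ≤ t + 1, X i ω = z' i} := by
      have : {ω | ∀ i ≤ t + 1, X i ω = z' i} =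
          {ω | ∀ i ≤ t, X i ω = z' i} ∩ {ω | X (t + 1) ω = y} := by
        ext ω
        simp only [Set.mem_inter_iff, Set.mem_ofPred_eq, Nat.le_succ_iff]
        constructor
        · exact fun h => ⟨fun i hi => h i (.inl hi), by rw [← hzt']; exact h _ (.inr rfl)⟩
        · rintro ⟨h1, h2⟩ i (hi | rfl)
          · exact h1 i hi
          · rw [hzt', h2]
      rw [this, ← h1]
      ext ω
      simp [and_assoc]
    rw [h1, h2, h.step t z', hzt, hzt']

variable [MeasurableSingletonClass S]

lemma measurable_residual {X : ℕ → Ω → S} (hX : ∀ t, Measurable (X t)) (j : S) (s : ℕ) :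
    Measurable (residual X j s) := by
  have hle (n : ℕ) : MeasurableSet {ω | (n : ℕ∞) ≤ residual X j s ω} := by
    simp_rw [le_residual_iff]
    have : {ω | ∀ i < n, X (s + i) ω ≠ j} = ⋂ i, ⋂ (_ : i < n), (X (s + i) ⁻¹' {j})ᶜ := by
      ext; simp
    rw [this]
    exact .iInter fun i => .iInter fun _ => (hX _ (measurableSet_singleton j)).compl
  refine ENat.measurable_iff.2 fun n => ?_
  have : residual X j s ⁻¹' {(n : ℕ∞)} =
      {ω | (n : ℕ∞) ≤ residual X j s ω} \ {ω | ((n + 1 : ℕ) : ℕ∞) ≤ residual X j s ω} := by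
    ext ω
    simp only [Set.mem_preimage, Set.mem_singleton_iff, Set.mem_sdiff, Set.mem_ofPred_eq, not_le]
    constructor
    · rintro h
      rw [h]
      exact ⟨le_rfl, by exact_mod_cast Nat.lt_succ_self n⟩
    · rintro ⟨h1, h2⟩
      exact le_antisymm (ENat.lt_add_one_iff (by simp) |>.1 (by simpa using h2)) h1
  rw [this]
  exact (hle n).diff (hle (n + 1))

variable [Fintype S]

lemma sum_real_inter_state (μ : Measure Ω) [IsFiniteMeasure μ] {f : Ω → S} (hf : Measurable f)
    (A : Set Ω) : μ.real A = ∑ x, μ.real (A ∩ {ω | f ω = x}) := by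
  have h := sum_measureReal_preimage_singleton (μ := μ.restrict A) (Finset.univ : Finset S)
    (f := f) fun y _ => hf (measurableSet_singleton y)
  simp only [Finset.coe_univ, Set.preimage_univ] at h
  rw [← Set.univ_inter A, ← measureReal_restrict_apply .univ, ← h]
  refine Finset.sum_congr rfl fun x _ => ?_
  rw [measureReal_restrict_apply (hf (measurableSet_singleton x)), Set.univ_inter, Set.inter_comm]
  rfl

variable [DecidableEq S] {P : Matrix S S ℝ} {μ : Measure Ω} [IsFiniteMeasure μ]
  {X : ℕ → Ω → S} {𝒜 : ℕ → Set Ω → Prop} {A : Set Ω} {t : ℕ} {j : S}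

/-- First-step analysis: the event `{X_t = x}` is absorbed into `A`, and the induction hypothesis is
applied at time `t + 1`. -/
lemma IsMarkovFor.real_inter_state_residual (h : IsMarkovFor P μ X 𝒜) (hA : 𝒜 t A) (n : ℕ)
    (x : S) : μ.real (A ∩ {ω | X t ω = x} ∩ {ω | (n : ℕ∞) ≤ residual X j t ω}) =
      μ.real (A ∩ {ω | X t ω = x}) * avoid P j n x := by
  induction n generalizing t A x with
  | zero => simp [avoid]
  | succ n ih =>
    by_cases hx : x = j
    · have : A ∩ {ω | X t ω = x} ∩ {ω | ((n + 1 : ℕ) : ℕ∞) ≤ residual X j t ω} = ∅ := by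
        ext ω
        simp only [Set.mem_inter_iff, Set.mem_ofPred_eq, le_residual_iff, Set.mem_empty_iff_false,
          iff_false, not_and, hx]
        exact fun h1 h2 => h2 0 (by lia) (by simpa using h1.2)
      rw [this]
      simp [avoid, hx]
    · rw [avoid_succ_of_ne _ hx, sum_real_inter_state μ (h.measurable (t + 1)), Finset.mul_sum]
      refine Finset.sum_congr rfl fun y _ => ?_
      have hset : A ∩ {ω | X t ω = x} ∩ {ω | ((n + 1 : ℕ) : ℕ∞) ≤ residual X j t ω} ∩
          {ω | X (t + 1) ω = y} = A ∩ {ω | X t ω = x} ∩ {ω | X (t + 1) ω = y} ∩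
          {ω | (n : ℕ∞) ≤ residual X j (t + 1) ω} := by
        ext ω
        simp only [Set.mem_inter_iff, Set.mem_ofPred_eq, le_residual_iff]
        constructor
        · rintro ⟨⟨h1, h2⟩, h3⟩
          refine ⟨⟨h1, h3⟩, fun i hi => ?_⟩
          have := h2 (i + 1) (by lia)
          rwa [add_right_comm, add_assoc t, add_comm i] at * 
        · rintro ⟨⟨h1, h3⟩, h2⟩
          refine ⟨⟨h1, fun i hi => ?_⟩, h3⟩
          rcases i with _ | i
          · rw [add_zero, h1.2]; exact hx
          · have := h2 i (by lia)
            rwa [add_assoc, add_comm 1] at this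
      rw [hset, ih (h.inter t A x hA), ← mul_assoc, ← h.step t A x y hA]
      congr 2
      ext ω
      simp [and_assoc]

lemma IsMarkovFor.real_inter_residual (h : IsMarkovFor P μ X 𝒜) (hA : 𝒜 t A) (n : ℕ) :
    μ.real (A ∩ {ω | (n : ℕ∞) ≤ residual X j t ω}) =
      ∑ x, μ.real (A ∩ {ω | X t ω = x}) * avoid P j n x := by
  rw [sum_real_inter_state μ (h.measurable t)]
  refine Finset.sum_congr rfl fun x _ => ?_
  rw [← h.real_inter_state_residual hA n x, Set.inter_right_comm]

lemma IsMarkovChain.real_le_hittingTime [IsProbabilityMeasure μ] {ν : S → ℝ}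
    (h : IsMarkovChain P ν μ X) (n : ℕ) :
    μ.real {ω | (n : ℕ∞) ≤ hittingTime X j ω} = ∑ x, ν x * avoid P j n x := by
  have hA : IsCylinder X 0 Set.univ := by
    have : Nonempty (ℕ → S) := ⟨fun _ => j⟩
    exact ⟨fun _ => j, by simp⟩
  have := h.isMarkovFor.real_inter_residual (j := j) hA n
  simpa [residual_zero, h.initial] using this

end Chain

/-! ### Tails of measures on `ℕ∞`. -/

section ENatMeasure

lemma toENNReal_eq_tsum (y : ℕ∞) :
    (y : ℝ≥0∞) = ∑' n : ℕ, Set.indicator {y : ℕ∞ | ((n + 1 : ℕ) : ℕ∞) ≤ y} 1 y := by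
  cases y with
  | top =>
    have : ∀ n : ℕ, Set.indicator {y : ℕ∞ | ((n + 1 : ℕ) : ℕ∞) ≤ y} (1 : ℕ∞ → ℝ≥0∞) ⊤ = 1 := by
      intro n
      simp
    simp only [this]
    simp
  | coe k =>
    rw [tsum_eq_sum (s := Finset.range k)]
    · rw [Finset.sum_congr rfl fun n hn => Set.indicator_of_mem (a := (k : ℕ∞)) ?_ _]
      · simp
      · simpa using Nat.cast_le.2 (Finset.mem_range.1 hn)
    · intro n hn
      refine Set.indicator_of_notMem ?_ _
      simp only [Set.mem_ofPred_eq, Nat.cast_le]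
      simpa using hn

lemma measurable_toENNReal {Ω : Type*} [MeasurableSpace Ω] {Y : Ω → ℕ∞} (hY : Measurable Y) :
    Measurable fun ω => (Y ω : ℝ≥0∞) :=
  (Measurable.of_discrete (f := ENat.toENNReal)).comp hY

/-- The tail formula for the mean. -/
lemma lintegral_toENNReal {Ω : Type*} [MeasurableSpace Ω] (μ : Measure Ω) {Y : Ω → ℕ∞}
    (hY : Measurable Y) :
    ∫⁻ ω, (Y ω : ℝ≥0∞) ∂μ = ∑' n : ℕ, μ {ω | ((n + 1 : ℕ) : ℕ∞) ≤ Y ω} := by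
  simp_rw [toENNReal_eq_tsum]
  rw [lintegral_tsum]
  · refine tsum_congr fun n => ?_
    exact lintegral_indicator_one
      (hY (.of_discrete : MeasurableSet {y : ℕ∞ | ((n + 1 : ℕ) : ℕ∞) ≤ y}))
  · intro n
    exact ((Measurable.of_discrete (f := Set.indicator {y : ℕ∞ | ((n + 1 : ℕ) : ℕ∞) ≤ y}
      (1 : ℕ∞ → ℝ≥0∞))).comp hY).aemeasurable

/-- Differences of consecutive tails give the finite atoms; continuity from above gives the atom at
`⊤`. -/
lemma measure_enat_ext {m₁ m₂ : Measure ℕ∞} [IsFiniteMeasure m₁] [IsFiniteMeasure m₂]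
    (h : ∀ n : ℕ, m₁.real {y | (n : ℕ∞) ≤ y} = m₂.real {y | (n : ℕ∞) ≤ y}) : m₁ = m₂ := by
  have h' (n : ℕ) : m₁ {y | (n : ℕ∞) ≤ y} = m₂ {y | (n : ℕ∞) ≤ y} :=
    (measureReal_eq_measureReal_iff).1 (h n)
  have hanti : Antitone fun n : ℕ => {y : ℕ∞ | (n : ℕ∞) ≤ y} :=
    fun a b hab y hy => (Nat.cast_le.2 hab : (a : ℕ∞) ≤ b).trans hy
  refine Measure.ext_of_singleton fun y => ?_
  cases y with
  | top =>
    have : ({⊤} : Set ℕ∞) = ⋂ n : ℕ, {y | (n : ℕ∞) ≤ y} := by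
      ext y
      simp [ENat.eq_top_iff_forall_ge]
    rw [this, hanti.measure_iInter (fun _ => MeasurableSet.of_discrete.nullMeasurableSet)
      ⟨0, measure_ne_top _ _⟩, hanti.measure_iInter
      (fun _ => MeasurableSet.of_discrete.nullMeasurableSet) ⟨0, measure_ne_top _ _⟩]
    simp_rw [h']
  | coe k =>
    have : ({(k : ℕ∞)} : Set ℕ∞) = {y | (k : ℕ∞) ≤ y} \ {y | ((k + 1 : ℕ) : ℕ∞) ≤ y} := by
      ext y
      cases y with
      | top => simp
      | coe l => simp only [Set.mem_singleton_iff, Set.mem_sdiff, Set.mem_ofPred_eq, Nat.cast_le,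
          Nat.cast_inj]; lia
    rw [this, measure_sdiff (hanti k.le_succ) MeasurableSet.of_discrete.nullMeasurableSet
      (measure_ne_top _ _), measure_sdiff (hanti k.le_succ)
      MeasurableSet.of_discrete.nullMeasurableSet (measure_ne_top _ _), h', h']

end ENatMeasure

/-! ### Events of the filtration. -/

section Filtration

variable {S Ω : Type*} [MeasurableSpace S] [MeasurableSingletonClass S] [mΩ : MeasurableSpace Ω]

lemma isMarkovFor_filtration {P : Matrix S S ℝ} {μ : Measure Ω} {X : ℕ → Ω → S}
    {ℱ : Filtration ℕ mΩ} (hX : Adapted ℱ X)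
    (h : ∀ (t : ℕ) (A : Set Ω), MeasurableSet[ℱ t] A → ∀ x y : S,
      μ.real (A ∩ {ω | X t ω = x ∧ X (t + 1) ω = y}) =
        μ.real (A ∩ {ω | X t ω = x}) * P x y) :
    IsMarkovFor P μ X fun t A => MeasurableSet[ℱ t] A where
  measurable t := (hX t).mono (ℱ.le t) le_rfl
  inter t _ x hA := ℱ.mono t.le_succ _ (hA.inter (hX t (measurableSet_singleton x)))
  step t A x y hA := h t A hA x y

lemma measurableSet_residual_zero_eq {X : ℕ → Ω → S} {ℱ : Filtration ℕ mΩ} (hX : Adapted ℱ X)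
    (j : S) (s : ℕ) : MeasurableSet[ℱ s] {ω | residual X j 0 ω = s} := by
  have : {ω | residual X j 0 ω = s} = (⋂ i, ⋂ (_ : i < s), (X i ⁻¹' {j})ᶜ) ∩ X s ⁻¹' {j} := by
    ext ω
    simp only [Set.mem_ofPred_eq, Set.mem_inter_iff, Set.mem_iInter, Set.mem_compl_iff,
      Set.mem_preimage, Set.mem_singleton_iff]
    constructor
    · intro h
      exact ⟨fun i hi => by simpa using le_residual_iff.1 h.ge i hi, eq_of_residual_eq h⟩
    · rintro ⟨h1, h2⟩
      refine le_antisymm ?_ (le_residual_iff.2 fun i hi => by simpa using h1 i hi)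
      refine (ENat.lt_add_one_iff (by simp)).1 ?_
      rw [← not_le]
      intro h3
      have h4 : ((s + 1 : ℕ) : ℕ∞) ≤ residual X j 0 ω := by exact_mod_cast h3
      exact le_residual_iff.1 h4 s (by lia) (by simpa using h2)
  rw [this]
  refine MeasurableSet.inter ?_ (hX s (measurableSet_singleton j))
  exact .iInter fun i => .iInter fun hi =>
    ℱ.mono hi.le _ (hX i (measurableSet_singleton j)).compl

end Filtration

/-! ### Laws of residual times given the past. -/

section Law

variable {S Ω : Type*} [Fintype S] [DecidableEq S] [MeasurableSpace S]
  [MeasurableSingletonClass S] [MeasurableSpace Ω]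
  {P : Matrix S S ℝ} {μ : Measure Ω} [IsFiniteMeasure μ] {X : ℕ → Ω → S}
  {𝒜 : ℕ → Set Ω → Prop} {A : Set Ω} {t : ℕ} {j : S} {π : S → ℝ}

/-- If `X t` has law `π` given `A`, the chain restarts from stationarity; `w` enters only through
its tails. -/
lemma IsMarkovFor.map_residual (h : IsMarkovFor P μ X 𝒜) (hA : 𝒜 t A)
    (hπ : ∀ x, μ.real (A ∩ {ω | X t ω = x}) = μ.real A * π x) {w : Measure ℕ∞}
    [IsFiniteMeasure w] (hw : ∀ n : ℕ, w.real {y | (n : ℕ∞) ≤ y} = ∑ x, π x * avoid P j n x) :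
    (μ.restrict A).map (residual X j t) = μ A • w := by
  have hR := measurable_residual h.measurable j t
  have := Measure.smul_finite w (measure_ne_top μ A)
  refine measure_enat_ext fun n => ?_
  rw [map_measureReal_apply hR .of_discrete, measureReal_restrict_apply (hR .of_discrete),
    measureReal_ennreal_smul_apply, hw, Set.inter_comm]
  refine (h.real_inter_residual hA n).trans ?_
  simp_rw [hπ, Finset.mul_sum, mul_assoc]
  rfl

/-- After a visit to `j`, the next visit takes time `1 / π_j` in the mean. -/
lemma IsMarkovFor.mul_lintegral_return (h : IsMarkovFor P μ X 𝒜) (hA : 𝒜 t A)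
    (hA' : 𝒜 (t + 1) A) (hAj : A ⊆ {ω | X t ω = j})
    (hP : P ∈ Matrix.rowStochastic ℝ S) (hirr : P.IsIrreducible) (hπ : IsStationary P π) :
    ENNReal.ofReal (π j) * ∫⁻ ω in A, (1 + (residual X j (t + 1) ω : ℝ≥0∞)) ∂μ = μ A := by
  have hR := measurable_residual h.measurable j (t + 1)
  have hstep (y : S) : μ.real (A ∩ {ω | X (t + 1) ω = y}) = μ.real A * P j y := by
    have := h.step t A j y hA
    rw [Set.inter_eq_left.2 hAj] at this
    rw [← this]
    congr 1
    ext ω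
    simp only [Set.mem_inter_iff, Set.mem_ofPred_eq]
    exact ⟨fun h => ⟨h.1, hAj h.1, h.2⟩, fun h => ⟨h.1, h.2.2⟩⟩
  have htail (n : ℕ) : ENNReal.ofReal (π j) * μ.restrict A {ω | (n : ℕ∞) ≤ residual X j (t + 1) ω}
      = μ A * ENNReal.ofReal (π j * ∑ y, P j y * avoid P j n y) := by
    have hm : MeasurableSet {ω | (n : ℕ∞) ≤ residual X j (t + 1) ω} :=
      hR (.of_discrete : MeasurableSet {y : ℕ∞ | (n : ℕ∞) ≤ y})
    rw [Measure.restrict_apply hm,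
      ← ofReal_measureReal (μ := μ) (s := A), ← ofReal_measureReal (μ := μ),
      ← ENNReal.ofReal_mul (hπ.prob.1 j), ← ENNReal.ofReal_mul measureReal_nonneg, Set.inter_comm]
    congr 1
    rw [h.real_inter_residual hA' n]
    simp_rw [hstep, Finset.mul_sum]
    exact Finset.sum_congr rfl fun y _ => by ring
  -- The summand `1`, the step out of `j`, becomes the `n = 0` term of the tail sum, so that Kac's
  -- series appears from its first term.
  have h1 : ∫⁻ ω in A, (1 + (residual X j (t + 1) ω : ℝ≥0∞)) ∂μ =
      ∑' n : ℕ, μ.restrict A {ω | (n : ℕ∞) ≤ residual X j (t + 1) ω} := by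
    rw [lintegral_add_left measurable_const, lintegral_toENNReal _ hR,
      lintegral_one]
    have h0 : {ω | ((0 : ℕ) : ℕ∞) ≤ residual X j (t + 1) ω} = Set.univ := by ext; simp
    rw [tsum_eq_zero_add' (f := fun n : ℕ => μ.restrict A {ω | (n : ℕ∞) ≤ residual X j (t + 1) ω})
      ENNReal.summable, h0]
  rw [h1, ← ENNReal.tsum_mul_left]
  simp_rw [htail]
  rw [ENNReal.tsum_mul_left, ← ENNReal.ofReal_tsum_of_nonneg, (hπ.hasSum_return hP hirr).tsum_eq]
  · simp
  · exact fun n => mul_nonneg (hπ.prob.1 j)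
      (Finset.sum_nonneg fun y _ => mul_nonneg (hP.1 j y) (avoid_nonneg hP n y))
  · exact (hπ.hasSum_return hP hirr).summable

end Law

/-! ### The chain at a strong stationary time. -/

section StrongStationaryTime

variable {S Ω : Type*} {X : ℕ → Ω → S} {T : Ω → ℕ∞} {j : S}

/-- The time from `T` until the next visit of `X` to `j`. -/
noncomputable def residualAt (X : ℕ → Ω → S) (j : S) (T : Ω → ℕ∞) (ω : Ω) : ℕ∞ :=
  -- At `T ω = ⊤` this takes the value at time `0`; the sum `T + residualAt` is `⊤` there
  -- regardless.
  residual X j (T ω).toNat ω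

lemma hittingTime_le_add_residualAt (ω : Ω) : residual X j 0 ω ≤ T ω + residualAt X j T ω := by
  cases hT : T ω with
  | top => simp
  | coe t => simpa [residualAt, hT] using add_residual_le (X := X) (j := j) (Nat.zero_le t) ω

lemma add_residualAt_eq_of_le {ω : Ω} (hω : T ω ≤ residual X j 0 ω) (hT : T ω ≠ ⊤) :
    T ω + residualAt X j T ω = residual X j 0 ω := by
  refine le_antisymm ?_ (hittingTime_le_add_residualAt ω)
  lift T ω to ℕ using hT with t ht
  rw [residualAt, ← ht, ENat.toNat_natCast]
  have h0 := le_residual_iff.1 hω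
  cases hV : residual X j 0 ω with
  | top => simp
  | coe v =>
    rw [hV, Nat.cast_le] at hω
    have h := add_residual_le (X := X) (j := j) hω ω
    refine h.trans ?_
    have hj := eq_of_residual_eq hV
    have : residual X j v ω < (1 : ℕ) := by
      rw [← not_le, le_residual_iff]
      exact fun h => h 0 one_pos hj
    rw [Nat.cast_one, Order.lt_one_iff] at this
    simp [this]

variable [MeasurableSpace S] [mΩ : MeasurableSpace Ω]

lemma IsStrongStationaryTime.measurable [Nonempty S] {P : Matrix S S ℝ} {μ : Measure Ω}
    {π : S → ℝ} (h : IsStrongStationaryTime P π μ X T) :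
    Measurable T := by
  obtain ⟨ℱ, -, -, (hT : IsStoppingTime ℱ T)⟩ := h.stopping
  exact ENat.measurable_iff.2 fun n => ℱ.le n _ (hT.measurableSet_eq n)

variable [MeasurableSingletonClass S]

lemma measurable_residualAt (hX : ∀ t, Measurable (X t)) (hT : Measurable T) :
    Measurable (residualAt X j T) := by
  have h : Measurable fun q : ℕ × Ω => residual X j q.1 q.2 :=
    measurable_from_prod_countable_right fun s => measurable_residual hX j s
  exact h.comp ((Measurable.of_discrete (f := ENat.toNat)).comp hT |>.prodMk measurable_id)

variable [Nonempty S] {P : Matrix S S ℝ} {μ : Measure Ω} {π : S → ℝ}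

lemma IsStrongStationaryTime.real_inter_state [IsProbabilityMeasure μ]
    (h : IsStrongStationaryTime P π μ X T) (s : ℕ) (x : S) :
    μ.real ({ω | T ω = s} ∩ {ω | X s ω = x}) = μ.real {ω | T ω = s} * π x := by
  have h1 := h.indep.measure_inter_preimage_eq_mul {x} {(s : ℕ∞)}
    (measurableSet_singleton x) (measurableSet_singleton _)
  have h2 : stoppedValue X T ⁻¹' {x} ∩ T ⁻¹' {(s : ℕ∞)} = {ω | T ω = s} ∩ {ω | X s ω = x} := by
    ext ω
    simp only [Set.mem_inter_iff, Set.mem_preimage, Set.mem_singleton_iff, Set.mem_ofPred_eq]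
    rw [and_comm]
    refine and_congr_right fun hs => ?_
    simp only [stoppedValue, hs]
    rfl
  rw [h2] at h1
  rw [measureReal_def, h1, ENNReal.toReal_mul, mul_comm]
  exact congrArg (_ * ·) (h.law x)

variable [Fintype S] [DecidableEq S]

/-- At a strong stationary time, the residual hitting time is a fresh copy of the stationary one. -/
lemma IsStrongStationaryTime.map_prodMk_residualAt [IsProbabilityMeasure μ]
    (h : IsStrongStationaryTime P π μ X T) {w : Measure ℕ∞}
    [IsProbabilityMeasure w] (hw : ∀ n : ℕ, w.real {y | (n : ℕ∞) ≤ y} = ∑ x, π x * avoid P j n x) :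
    μ.map (fun ω => (T ω, residualAt X j T ω)) = (μ.map T).prod w := by
  have hTm := h.measurable
  obtain ⟨ℱ, hX, hstep, hT⟩ := h.stopping
  have hM := isMarkovFor_filtration hX hstep
  have hR := measurable_residualAt (j := j) hM.measurable hTm
  refine Measure.ext_of_singleton fun ⟨s, r⟩ => ?_
  rw [Measure.map_apply (hTm.prodMk hR) (measurableSet_singleton _), ← Set.singleton_prod_singleton,
    Measure.prod_prod, Measure.map_apply hTm (measurableSet_singleton _)]
  cases s with
  | top =>
    have h0 : μ (T ⁻¹' {⊤}) = 0 := by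
      have := h.finite
      rw [ae_iff] at this
      simp only [ne_eq, not_not] at this
      exact this
    rw [h0, zero_mul]
    exact measure_mono_null (fun ω hω => by simpa using (hω : _ ∧ _).1) h0
  | coe s =>
    -- The event `{T = s}` lies in `ℱ s`, and given it `X s` has law `π`: this is where independence
    -- of `X_T` and `T` enters.
    have := hM.map_residual (j := j) (hT.measurableSet_eq s) (h.real_inter_state s) hw
    have h1 := congrArg (fun m => m {r}) this
    simp only [Measure.smul_apply, smul_eq_mul] at h1
    have hRs := measurable_residual hM.measurable j s
    rw [Measure.map_apply hRs (measurableSet_singleton _),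
      Measure.restrict_apply (hRs (measurableSet_singleton _))] at h1
    refine Eq.trans ?_ h1
    congr 1
    ext ω
    simp only [Set.mem_preimage, Set.mem_prod, Set.mem_singleton_iff, Set.mem_inter_iff,
      Set.mem_ofPred_eq]
    rw [and_comm]
    refine and_congr_left fun hs => ?_
    rw [residualAt, hs]
    rfl

/-- If `j` is hit before `T`, the first visit to `j` from `T` on is at best the second visit
overall, and the extra return time costs `1 / π j` in the mean. -/
lemma IsStrongStationaryTime.measure_lt_add_le [IsProbabilityMeasure μ]
    (h : IsStrongStationaryTime P π μ X T) (hP : P ∈ Matrix.rowStochastic ℝ S)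
    (hirr : P.IsIrreducible) (hπ : IsStationary P π) :
    μ {ω | residual X j 0 ω < T ω} + ENNReal.ofReal (π j) * expect μ (residual X j 0) ≤
      ENNReal.ofReal (π j) * (expect μ T + expect μ (residualAt X j T)) := by
  have hTm := h.measurable
  obtain ⟨ℱ, hX, hstep, hT⟩ := h.stopping
  have hM := isMarkovFor_filtration hX hstep
  have hR := measurable_residualAt (j := j) hM.measurable hTm
  have hres := measurable_residual hM.measurable j
  -- The event that the first visit occurs at time `s` and `T > s`. It is decided at time `s`, so it
  -- does not bias the return time that follows.
  let C (s : ℕ) : Set Ω := {ω | residual X j 0 ω = s} ∩ {ω | T ω ≤ s}ᶜ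
  have hC (s : ℕ) : MeasurableSet[ℱ s] (C s) :=
    (measurableSet_residual_zero_eq hX j s).inter (hT s).compl
  have hCm (s : ℕ) : MeasurableSet (C s) := ℱ.le s _ (hC s)
  have hdisj : Pairwise (Function.onFun Disjoint C) := by
    intro s t hst
    refine Set.disjoint_left.2 fun ω h1 h2 => hst ?_
    have := (h1.1 : residual X j 0 ω = s).symm.trans h2.1
    exact_mod_cast this
  have hunion : {ω | residual X j 0 ω < T ω} = ⋃ s, C s := by
    ext ω
    simp only [Set.mem_ofPred_eq, Set.mem_iUnion, C, Set.mem_inter_iff, Set.mem_compl_iff, not_le]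
    constructor
    · intro hlt
      obtain ⟨v, hv⟩ := ENat.ne_top_iff_exists.1 hlt.ne_top
      exact ⟨v, hv.symm, hv ▸ hlt⟩
    · rintro ⟨s, h1, h2⟩
      exact h1 ▸ h2
  let f (s : ℕ) : Ω → ℝ≥0∞ := (C s).indicator fun ω => 1 + (residual X j (s + 1) ω : ℝ≥0∞)
  have hpt (ω : Ω) : (residual X j 0 ω : ℝ≥0∞) + ∑' s, f s ω ≤
      (T ω : ℝ≥0∞) + (residualAt X j T ω : ℝ≥0∞) := by
    by_cases hω : ∃ s, ω ∈ C s
    · obtain ⟨s, hs⟩ := hω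
      rw [tsum_eq_single s fun t ht => Set.indicator_of_notMem
        (fun h' => Set.disjoint_left.1 (hdisj ht) h' hs) _]
      simp only [Set.indicator_of_mem hs]
      obtain ⟨h1, h2⟩ := hs
      rw [Set.mem_ofPred_eq] at h1
      rw [h1]
      cases hTω : T ω with
      | top => simp
      | coe t =>
        have hst : s + 1 ≤ t := by
          simpa [hTω] using h2
        have := add_residual_le (X := X) (j := j) hst ω
        rw [residualAt, hTω, ENat.toNat_natCast, ← add_assoc]
        have := ENat.toENNReal_le.2 this
        simpa using this
    · rw [ENNReal.tsum_eq_zero.2 fun s => Set.indicator_of_notMem (fun h => hω ⟨s, h⟩) _, add_zero,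
        ← ENat.toENNReal_add]
      exact ENat.toENNReal_le.2 (hittingTime_le_add_residualAt ω)
  have hmono := lintegral_mono (μ := μ) hpt
  have hf (s : ℕ) : Measurable fun ω => 1 + (residual X j (s + 1) ω : ℝ≥0∞) :=
    measurable_const.add (measurable_toENNReal (hres (s + 1)))
  rw [lintegral_add_left (measurable_toENNReal (hres 0)),
    lintegral_add_left (measurable_toENNReal hTm),
    lintegral_tsum fun s => ((hf s).indicator (hCm s)).aemeasurable] at hmono
  have hsum : ENNReal.ofReal (π j) * ∑' s, ∫⁻ ω, f s ω ∂μ = μ {ω | residual X j 0 ω < T ω} := by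
    rw [hunion, measure_iUnion hdisj hCm, ← ENNReal.tsum_mul_left]
    refine tsum_congr fun s => ?_
    rw [lintegral_indicator (hCm s)]
    exact hM.mul_lintegral_return (hC s) (ℱ.mono s.le_succ _ (hC s))
      (fun ω hω => eq_of_residual_eq hω.1) hP hirr hπ
  calc _ = ENNReal.ofReal (π j) * (expect μ (residual X j 0) + ∑' s, ∫⁻ ω, f s ω ∂μ) := by
        rw [mul_add, hsum, add_comm]
    _ ≤ _ := by exact mul_le_mul_right hmono _

end StrongStationaryTime

/-! ### Total variation, convolution and coupling. -/

section Convolution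

lemma conv_apply_eq_lintegral (t m : Measure ℕ∞) [SFinite m] (A : Set ℕ∞) :
    (t.conv m) A = ∫⁻ x, m ((fun y => x + y) ⁻¹' A) ∂t := by
  rw [Measure.conv, Measure.map_apply measurable_add .of_discrete,
    Measure.prod_apply (measurable_add .of_discrete)]
  rfl

lemma conv_real_eq_integral (t m : Measure ℕ∞) [IsFiniteMeasure m] (A : Set ℕ∞) :
    (t.conv m).real A = ∫ x, m.real ((fun y => x + y) ⁻¹' A) ∂t := by
  rw [measureReal_def, conv_apply_eq_lintegral]
  simp_rw [measureReal_def]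
  rw [integral_toReal Measurable.of_discrete.aemeasurable (.of_forall fun x => measure_lt_top _ _)]

lemma tvDist_le {m₁ m₂ : Measure ℕ∞} {c : ℝ} (h : ∀ A, |m₁.real A - m₂.real A| ≤ c) :
    tvDist m₁ m₂ ≤ c := ciSup_le h

lemma abs_real_sub_le_tvDist (m₁ m₂ : Measure ℕ∞) [IsProbabilityMeasure m₁]
    [IsProbabilityMeasure m₂] (A : Set ℕ∞) : |m₁.real A - m₂.real A| ≤ tvDist m₁ m₂ := by
  refine le_ciSup (f := fun A : Set ℕ∞ => |m₁.real A - m₂.real A|) ⟨1, ?_⟩ A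
  rintro _ ⟨B, rfl⟩
  have h1 : m₁.real B ≤ 1 := measureReal_le_one
  have h2 : m₂.real B ≤ 1 := measureReal_le_one
  have h3 : 0 ≤ m₁.real B := measureReal_nonneg
  have h4 : 0 ≤ m₂.real B := measureReal_nonneg
  exact abs_le.2 ⟨by linarith, by linarith⟩

/-- Conditionally on the first summand `x`, the comparison is between `m₁` and `m₂` on a translate
of `A`; averaging over `x` keeps the bound. -/
lemma abs_conv_real_sub_le (t m₁ m₂ : Measure ℕ∞) [IsProbabilityMeasure t]
    [IsProbabilityMeasure m₁] [IsProbabilityMeasure m₂] (A : Set ℕ∞) :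
    |(t.conv m₁).real A - (t.conv m₂).real A| ≤ tvDist m₁ m₂ := by
  have hint (m : Measure ℕ∞) [IsProbabilityMeasure m] :
      Integrable (fun x => m.real ((fun y => x + y) ⁻¹' A)) t :=
    .of_bound Measurable.of_discrete.aestronglyMeasurable 1 (.of_forall fun x => by
      rw [Real.norm_of_nonneg measureReal_nonneg]; exact measureReal_le_one)
  rw [conv_real_eq_integral, conv_real_eq_integral, ← integral_sub (hint m₁) (hint m₂)]
  have := norm_integral_le_of_norm_le_const (μ := t) (C := tvDist m₁ m₂)
    (f := fun x => m₁.real ((fun y => x + y) ⁻¹' A) - m₂.real ((fun y => x + y) ⁻¹' A))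
    (.of_forall fun x => abs_real_sub_le_tvDist m₁ m₂ _)
  simpa using this

/-- If `w` almost solves the convolution equation solved by the geometric sum `u`, then it is close
to `u`. -/
lemma mul_tvDist_le {p q : ℝ} (hp1 : p ≤ 1) {t u v w : Measure ℕ∞}
    [IsProbabilityMeasure t] [IsProbabilityMeasure u] [IsProbabilityMeasure w]
    (hu : ∀ A, u.real A = p * (Measure.dirac (0 : ℕ∞)).real A + (1 - p) * (t.conv u).real A)
    (hw : ∀ A, w.real A = p * (Measure.dirac (0 : ℕ∞)).real A + (1 - p) * v.real A)
    (hv : ∀ A, |v.real A - (t.conv w).real A| ≤ q) :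
    p * tvDist w u ≤ (1 - p) * q := by
  have h : tvDist w u ≤ (1 - p) * (q + tvDist w u) := by
    refine tvDist_le fun A => ?_
    have : w.real A - u.real A = (1 - p) * ((v.real A - (t.conv w).real A) +
        ((t.conv w).real A - (t.conv u).real A)) := by rw [hu A, hw A]; ring
    rw [this, abs_mul, abs_of_nonneg (by linarith)]
    refine mul_le_mul_of_nonneg_left ?_ (by linarith)
    exact (abs_add_le _ _).trans (add_le_add (hv A) (abs_conv_real_sub_le t w u A))
  linarith

/-- Coupling inequality: the variables can disagree only on `B`. -/
lemma abs_map_real_sub_map_real_le {Ω : Type*} [MeasurableSpace Ω] {μ : Measure Ω}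
    [IsFiniteMeasure μ] {f g : Ω → ℕ∞} (hf : Measurable f) (hg : Measurable g) {B : Set Ω}
    (h : ∀ᵐ ω ∂μ, ω ∉ B → f ω = g ω) (A : Set ℕ∞) :
    |(μ.map f).real A - (μ.map g).real A| ≤ μ.real B := by
  have key {f g : Ω → ℕ∞} (h : ∀ᵐ ω ∂μ, ω ∉ B → f ω = g ω) :
      μ.real (f ⁻¹' A) ≤ μ.real (g ⁻¹' A) + μ.real B := by
    refine le_trans ?_ (measureReal_union_le _ _)
    refine ENNReal.toReal_mono (measure_ne_top _ _) (measure_mono_ae ?_)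
    filter_upwards [h] with ω hω hωA
    by_cases hB : ω ∈ B
    · exact .inr hB
    · left
      change g ω ∈ A
      rw [← hω hB]
      exact hωA
  rw [map_measureReal_apply hf .of_discrete, map_measureReal_apply hg .of_discrete, abs_le]
  have h1 := key h
  have h2 := key (h.mono fun ω hω hB => (hω hB).symm)
  constructor <;> linarith

end Convolution

/-! ### The renewal equation for a geometric sum. -/

section GeometricSum

variable {Ω Ω' : Type*} [MeasurableSpace Ω] [MeasurableSpace Ω'] {p : ℝ} {T : Ω' → ℕ∞}
  {μ' : Measure Ω'} {μ : Measure Ω} [IsProbabilityMeasure μ] {U : Ω → ℕ∞}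

lemma map_geometricSum_apply {N : Ω → ℕ} {τ : ℕ → Ω → ℕ∞} (hN : IsGeometric p μ N)
    (hτ : ∀ i, AEMeasurable (τ i) μ) (hNτ : IndepFun N (fun ω i => τ i ω) μ)
    (hU : ∀ ω, U ω = ∑ i ∈ Finset.range (N ω), τ i ω) :
    AEMeasurable U μ ∧ ∀ A, μ.map U A = ∑' k : ℕ, ENNReal.ofReal (p * (1 - p) ^ k) *
      μ.map (fun ω => ∑ i ∈ Finset.range k, τ i ω) A := by
  have hσ (k : ℕ) : AEMeasurable (fun ω => ∑ i ∈ Finset.range k, τ i ω) μ :=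
    Finset.aemeasurable_fun_sum _ fun i _ => hτ i
  have hpre (A : Set ℕ∞) : U ⁻¹' A =
      ⋃ k, (N ⁻¹' {k} ∩ (fun ω => ∑ i ∈ Finset.range k, τ i ω) ⁻¹' A) := by
    ext ω
    simp [hU]
  have hnull (A : Set ℕ∞) (k : ℕ) : NullMeasurableSet
      (N ⁻¹' {k} ∩ (fun ω => ∑ i ∈ Finset.range k, τ i ω) ⁻¹' A) μ :=
    (hN.measurable (measurableSet_singleton k)).nullMeasurableSet.inter
      ((hσ k).nullMeasurableSet_preimage .of_discrete)
  have hUm : AEMeasurable U μ := by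
    refine NullMeasurable.aemeasurable fun A _ => ?_
    rw [hpre]
    exact .iUnion (hnull A)
  refine ⟨hUm, fun A => ?_⟩
  rw [Measure.map_apply_of_aemeasurable hUm .of_discrete, hpre, measure_iUnion₀ ?_ (hnull A)]
  · refine tsum_congr fun k => ?_
    have hind : IndepFun N (fun ω => ∑ i ∈ Finset.range k, τ i ω) μ :=
      hNτ.comp (φ := id) (ψ := fun f : ℕ → ℕ∞ => ∑ i ∈ Finset.range k, f i) measurable_id
        (Finset.measurable_fun_sum _ fun i _ => measurable_pi_apply i)
    rw [hind.measure_inter_preimage_eq_mul _ _ (measurableSet_singleton k) .of_discrete,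
      Measure.map_apply_of_aemeasurable (hσ k) .of_discrete, ← hN.law k, ofReal_measureReal]
    rfl
  · refine fun k l hkl => Disjoint.aedisjoint (Set.disjoint_left.2 fun ω h1 h2 => hkl ?_)
    exact (h1.1 : N ω = k).symm.trans h2.1

/-- The law `u` of a geometric sum solves `u = p δ₀ + (1 - p) t ∗ u`. -/
lemma IsGeometricSum.real_eq (h : IsGeometricSum p T μ' μ U) (hp0 : 0 ≤ p) (hp1 : p ≤ 1) :
    IsProbabilityMeasure (μ.map U) ∧ ∀ A, (μ.map U).real A =
      p * (Measure.dirac (0 : ℕ∞)).real A + (1 - p) * ((μ'.map T).conv (μ.map U)).real A := by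
  obtain ⟨N, τ, hN, hid, hind, hNτ, hU⟩ := h
  have hτ i := (hid i).aemeasurable_fst
  obtain ⟨hUm, hmap⟩ := map_geometricSum_apply hN hτ hNτ hU
  have hprob : IsProbabilityMeasure (μ.map U) := Measure.isProbabilityMeasure_map hUm
  have hprobT : IsProbabilityMeasure (μ'.map T) := by
    rw [← (hid 0).map_eq]
    exact Measure.isProbabilityMeasure_map (hτ 0)
  have hσ (k : ℕ) : AEMeasurable (fun ω => ∑ i ∈ Finset.range k, τ i ω) μ :=
    Finset.aemeasurable_fun_sum _ fun i _ => hτ i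
  refine ⟨hprob, fun A => ?_⟩
  set m : ℕ → Measure ℕ∞ := fun k => μ.map fun ω => ∑ i ∈ Finset.range k, τ i ω with hm
  have hmp (k : ℕ) : IsProbabilityMeasure (m k) := Measure.isProbabilityMeasure_map (hσ k)
  have hm0 : m 0 = Measure.dirac 0 := by simp [hm, Measure.map_const]
  have hm1 (k : ℕ) : m (k + 1) = (μ'.map T).conv (m k) := by
    have h1 := hind.indepFun_finsetSum_of_notMem₀ hτ (Finset.notMem_range_self (n := k))
    have h2 := h1.map_add_eq_map_conv_map₀ (Finset.aemeasurable_sum _ fun i _ => hτ i) (hτ k)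
    rw [Measure.conv_comm, ← (hid k).map_eq]
    refine Eq.trans ?_ (h2.trans ?_)
    · refine congrArg (fun f => μ.map f) ?_
      ext ω
      simp [Finset.sum_range_succ]
    · simp only [hm]
      congr 2
      ext ω
      simp
  have hconv : ((μ'.map T).conv (μ.map U)) A =
      ∑' k : ℕ, ENNReal.ofReal (p * (1 - p) ^ k) * m (k + 1) A := by
    rw [conv_apply_eq_lintegral]
    simp_rw [hmap, hm1, conv_apply_eq_lintegral]
    rw [lintegral_tsum fun k => Measurable.of_discrete.aemeasurable]
    exact tsum_congr fun k => lintegral_const_mul _ .of_discrete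
  have hENN : μ.map U A = ENNReal.ofReal p * Measure.dirac (0 : ℕ∞) A +
      ENNReal.ofReal (1 - p) * ((μ'.map T).conv (μ.map U)) A := by
    -- The `k = 0` term is the atom at `0`; in the others one factor `1 - p` and one convolution
    -- with the law of `T` are pulled out.
    rw [hmap, tsum_eq_zero_add' ENNReal.summable, hconv, ← ENNReal.tsum_mul_left]
    congr 1
    · rw [← hm0]; simp [hm]
    · refine tsum_congr fun k => ?_
      rw [← mul_assoc, ← ENNReal.ofReal_mul (by linarith)]
      congr 2
      ring
  rw [measureReal_def, hENN, ENNReal.toReal_add (by finiteness) (by finiteness),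
    ENNReal.toReal_mul, ENNReal.toReal_mul, ENNReal.toReal_ofReal hp0,
    ENNReal.toReal_ofReal (by linarith)]
  rfl

end GeometricSum

/-! ### Comparing the starting laws `π` and `π⁽ʲ⁾`. -/

section HittingTime

lemma IsMarkovChain.measurable_hittingTime {S Ω : Type*} [MeasurableSpace S]
    [MeasurableSingletonClass S] [MeasurableSpace Ω] {P : Matrix S S ℝ} {ν : S → ℝ} {j : S}
    {μ : Measure Ω} {X : ℕ → Ω → S} (hX : IsMarkovChain P ν μ X) :
    Measurable (hittingTime X j) :=
  residual_zero X j ▸ measurable_residual hX.measurable j 0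

variable {S Ω Ω' : Type*} [Fintype S] [DecidableEq S] [MeasurableSpace S]
  [MeasurableSingletonClass S] [MeasurableSpace Ω] [MeasurableSpace Ω']
  {P : Matrix S S ℝ} {π : S → ℝ} {j : S}
  {μ : Measure Ω} [IsProbabilityMeasure μ] {X : ℕ → Ω → S}
  {μ' : Measure Ω'} [IsProbabilityMeasure μ'] {X' : ℕ → Ω' → S} {T : Ω' → ℕ∞}

lemma IsMarkovChain.map_hittingTime_real {ν : S → ℝ} (hX : IsMarkovChain P ν μ X) (n : ℕ) :
    (μ.map (hittingTime X j)).real {y | (n : ℕ∞) ≤ y} = ∑ x, ν x * avoid P j n x := by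
  rw [map_measureReal_apply hX.measurable_hittingTime .of_discrete]
  exact hX.real_le_hittingTime n

lemma IsMarkovChain.expect_hittingTime_ne_top {ν : S → ℝ} (hX : IsMarkovChain P ν μ X)
    (hP : P ∈ Matrix.rowStochastic ℝ S) (hirr : P.IsIrreducible) :
    expect μ (hittingTime X j) ≠ ⊤ := by
  rw [expect, lintegral_toENNReal μ hX.measurable_hittingTime]
  have h (n : ℕ) : μ {ω | ((n + 1 : ℕ) : ℕ∞) ≤ hittingTime X j ω} =
      ENNReal.ofReal (∑ x, ν x * avoid P j (n + 1) x) := by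
    rw [← hX.real_le_hittingTime, ofReal_measureReal]
  simp_rw [h]
  have hs : Summable fun n => ∑ x, ν x * avoid P j (n + 1) x :=
    summable_sum fun x _ => ((summable_nat_add_iff 1).2 (summable_avoid hP hirr x)).mul_left _
  exact hs.tsum_ofReal_ne_top

/-- The hitting time from stationarity is a mixture of `0` and the hitting time from `π⁽ʲ⁾`. -/
lemma map_hittingTime_eq_mixture (hX : IsMarkovChain P π μ X)
    (hX' : IsMarkovChain P (restrictAway π j) μ' X') (hp0 : 0 ≤ π j)
    (hp1 : π j < 1) :
    μ.map (hittingTime X j) = ENNReal.ofReal (π j) • Measure.dirac 0 +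
      ENNReal.ofReal (1 - π j) • μ'.map (hittingTime X' j) := by
  have hp : 1 - π j ≠ 0 := by linarith
  have i1 := Measure.smul_finite (Measure.dirac (0 : ℕ∞)) (ENNReal.ofReal_ne_top (r := π j))
  have i2 := Measure.smul_finite (μ'.map (hittingTime X' j)) (ENNReal.ofReal_ne_top (r := 1 - π j))
  refine measure_enat_ext fun n => ?_
  rw [measureReal_add_apply, measureReal_ennreal_smul_apply, measureReal_ennreal_smul_apply,
    hX.map_hittingTime_real, hX'.map_hittingTime_real, ENNReal.toReal_ofReal hp0,
    ENNReal.toReal_ofReal (by linarith)]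
  have h0 : (Measure.dirac (0 : ℕ∞)).real {y | (n : ℕ∞) ≤ y} = avoid P j n j := by
    rw [measureReal_def, Measure.dirac_apply' _ .of_discrete]
    cases n with
    | zero => simp [avoid_zero]
    | succ n => simp [avoid_succ_self]
  rw [h0, Finset.mul_sum]
  have h1 (x : S) : (1 - π j) * (restrictAway π j x * avoid P j n x) =
      π x * avoid P j n x - if x = j then π j * avoid P j n j else 0 := by
    rw [restrictAway]
    split_ifs with hx
    · subst hx; field_simp
    · field_simp; ring
  simp_rw [h1]
  simp

lemma expect_hittingTime_eq (hX : IsMarkovChain P π μ X)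
    (hX' : IsMarkovChain P (restrictAway π j) μ' X') (hp0 : 0 ≤ π j)
    (hp1 : π j < 1) :
    expect μ (hittingTime X j) = ENNReal.ofReal (1 - π j) * expect μ' (hittingTime X' j) := by
  have hm : Measurable ENat.toENNReal := .of_discrete
  have h1 : expect μ' (hittingTime X' j) =
      ∫⁻ y, (y : ℝ≥0∞) ∂(μ'.map (hittingTime X' j)) :=
    (lintegral_map hm hX'.measurable_hittingTime).symm
  have h2 : expect μ (hittingTime X j) =
      ∫⁻ y, (y : ℝ≥0∞) ∂(μ.map (hittingTime X j)) :=
    (lintegral_map hm hX.measurable_hittingTime).symm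
  rw [h1, h2, map_hittingTime_eq_mixture hX hX' hp0 hp1, lintegral_add_measure,
    lintegral_smul_measure, lintegral_smul_measure, lintegral_dirac]
  simp

variable [Nonempty S]

lemma IsStrongStationaryTime.map_add_residualAt (hX : IsMarkovChain P π μ X)
    (hX' : ∀ t, Measurable (X' t)) (hT : IsStrongStationaryTime P π μ' X' T) :
    μ'.map (fun ω => T ω + residualAt X' j T ω) =
      (μ'.map T).conv (μ.map (hittingTime X j)) := by
  have := Measure.isProbabilityMeasure_map (μ := μ)
    (hX.measurable_hittingTime (j := j)).aemeasurable
  rw [Measure.conv, ← hT.map_prodMk_residualAt hX.map_hittingTime_real,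
    Measure.map_map measurable_add (hT.measurable.prodMk (measurable_residualAt hX' hT.measurable))]
  rfl

lemma IsStrongStationaryTime.expect_residualAt (hX : IsMarkovChain P π μ X)
    (hX' : ∀ t, Measurable (X' t)) (hT : IsStrongStationaryTime P π μ' X' T) :
    expect μ' (residualAt X' j T) = expect μ (hittingTime X j) := by
  have hR := measurable_residualAt (j := j) hX' hT.measurable
  have hTp := Measure.isProbabilityMeasure_map (μ := μ') hT.measurable.aemeasurable
  have := Measure.isProbabilityMeasure_map (μ := μ)
    (hX.measurable_hittingTime (j := j)).aemeasurable
  have h := congrArg (Measure.map Prod.snd)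
    (hT.map_prodMk_residualAt (hX.map_hittingTime_real (j := j)))
  rw [Measure.map_map measurable_snd (hT.measurable.prodMk hR), Measure.map_snd_prod,
    measure_univ, one_smul] at h
  have hm : Measurable ENat.toENNReal := .of_discrete
  have h1 : expect μ' (residualAt X' j T) =
      ∫⁻ y, (y : ℝ≥0∞) ∂(μ'.map (residualAt X' j T)) := (lintegral_map hm hR).symm
  have h2 : expect μ (hittingTime X j) =
      ∫⁻ y, (y : ℝ≥0∞) ∂(μ.map (hittingTime X j)) :=
    (lintegral_map hm hX.measurable_hittingTime).symm
  rw [h1, h2, ← h]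
  rfl

end HittingTime

end MarkovHitting

/-! ### Assembling the bound. -/

theorem mainTheorem1
    {S : Type*} [Fintype S] [DecidableEq S] [Nontrivial S]
    [MeasurableSpace S] [MeasurableSingletonClass S]
    (P : Matrix S S ℝ) (hP : MarkovHitting.IsErgodic P)
    (π : S → ℝ) (hπ : MarkovHitting.IsStationary P π) (j : S)
    -- the chain started from `π`
    {Ω : Type*} [MeasurableSpace Ω] (μ : Measure Ω) [IsProbabilityMeasure μ]
    (X : ℕ → Ω → S) (hX : MarkovHitting.IsMarkovChain P π μ X)
    -- the chain started from `π⁽ʲ⁾`, with a strong stationary time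
    {Ω' : Type*} [MeasurableSpace Ω'] (μ' : Measure Ω') [IsProbabilityMeasure μ']
    (X' : ℕ → Ω' → S)
    (hX' : MarkovHitting.IsMarkovChain P (MarkovHitting.restrictAway π j) μ' X')
    (T : Ω' → ℕ∞) (hT : MarkovHitting.IsStrongStationaryTime P π μ' X' T)
    -- the geometric sum
    {Ω'' : Type*} [MeasurableSpace Ω''] (μ'' : Measure Ω'') [IsProbabilityMeasure μ'']
    (U : Ω'' → ℕ∞) (hU : MarkovHitting.IsGeometricSum (π j) T μ' μ'' U) :
    ((MarkovHitting.tvDist (μ.map (MarkovHitting.hittingTime X j)) (μ''.map U) : ℝ) : EReal) ≤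
      ((1 - π j : ℝ) : EReal) * (MarkovHitting.expect μ' T : EReal) -
        ((π j : ℝ) : EReal) * (MarkovHitting.expect μ (MarkovHitting.hittingTime X j) : EReal) := by
  open MarkovHitting in
  have hp0 : 0 < π j := hπ.pos hP.stochastic hP.irreducible j
  have hp1 : π j < 1 := hπ.lt_one hP.stochastic hP.irreducible
  have hTp := Measure.isProbabilityMeasure_map (μ := μ') hT.measurable.aemeasurable
  have hWp := Measure.isProbabilityMeasure_map (μ := μ)
    (hX.measurable_hittingTime (j := j)).aemeasurable
  obtain ⟨hUp, hUeq⟩ := hU.real_eq hp0.le hp1.le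
  have hmix := map_hittingTime_eq_mixture hX hX' hp0.le hp1
  have htv : π j * tvDist (μ.map (hittingTime X j)) (μ''.map U) ≤
      (1 - π j) * μ'.real {ω | residual X' j 0 ω < T ω} := by
    refine mul_tvDist_le hp1.le (v := μ'.map (hittingTime X' j)) hUeq (fun A => ?_) fun A => ?_
    · have i1 := Measure.smul_finite (Measure.dirac (0 : ℕ∞)) (ENNReal.ofReal_ne_top (r := π j))
      have i2 := Measure.smul_finite (μ'.map (hittingTime X' j))
        (ENNReal.ofReal_ne_top (r := 1 - π j))
      rw [hmix, measureReal_add_apply, measureReal_ennreal_smul_apply,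
        measureReal_ennreal_smul_apply, ENNReal.toReal_ofReal hp0.le,
        ENNReal.toReal_ofReal (by linarith)]
    · rw [← hT.map_add_residualAt hX hX'.measurable]
      refine abs_map_real_sub_map_real_le hX'.measurable_hittingTime
        (hT.measurable.add (measurable_residualAt hX'.measurable hT.measurable)) ?_ A
      filter_upwards [hT.finite] with ω hω hlt
      rw [← residual_zero, Pi.add_apply, add_residualAt_eq_of_le (not_lt.1 hlt) hω]
  have hineq := hT.measure_lt_add_le (j := j) hP.stochastic hP.irreducible hπ
  rw [hT.expect_residualAt hX hX'.measurable, residual_zero] at hineq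
  have hW := expect_hittingTime_eq hX hX' hp0.le hp1
  have hWfin := hX.expect_hittingTime_ne_top (j := j) hP.stochastic hP.irreducible
  have hVfin := hX'.expect_hittingTime_ne_top (j := j) hP.stochastic hP.irreducible
  rw [residual_zero] at htv
  generalize expect μ (hittingTime X j) = eW at *
  generalize expect μ' (hittingTime X' j) = eV at *
  generalize expect μ' T = eT at *
  lift eW to NNReal using hWfin
  lift eV to NNReal using hVfin
  -- `𝔼W` is finite, so for `𝔼T = ⊤` the right-hand side is `⊤` rather than an indeterminate
  -- difference.
  by_cases hTfin : eT = ⊤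
  · rw [hTfin, EReal.coe_ennreal_top, EReal.coe_mul_top_of_pos (by linarith)]
    have : ((π j : ℝ) : EReal) * (((eW : NNReal) : ℝ≥0∞) : EReal) = ((π j * eW : ℝ) : EReal) := by
      push_cast; rfl
    rw [this, EReal.top_sub_coe]
    exact le_top
  · lift eT to NNReal using hTfin
    have hW' : (eW : ℝ) = (1 - π j) * eV := by
      have := congrArg ENNReal.toReal hW
      rwa [ENNReal.toReal_mul, ENNReal.toReal_ofReal (by linarith)] at this
    have hineq' : μ'.real {ω | hittingTime X' j ω < T ω} + π j * eV ≤ π j * (eT + eW) := by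
      have := ENNReal.toReal_mono (by finiteness) hineq
      rwa [ENNReal.toReal_add (by finiteness) (by finiteness), ENNReal.toReal_mul,
        ENNReal.toReal_mul, ENNReal.toReal_add (by finiteness) (by finiteness),
        ENNReal.toReal_ofReal hp0.le] at this
    have hreal : tvDist (μ.map (hittingTime X j)) (μ''.map U) ≤ (1 - π j) * eT - π j * eW := by
      refine le_of_mul_le_mul_left (htv.trans ?_) hp0
      -- Multiply the bound on `q` by `1 - π j` and replace `(1 - π j) 𝔼V` by `𝔼W`: the result is `π
      -- j` times the claimed bound.
      nlinarith [mul_le_mul_of_nonneg_left hineq' (sub_nonneg.2 hp1.le)]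
    have := EReal.coe_le_coe_iff.2 hreal
    push_cast at this
    exact this
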